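/- **Setting.** Fix $n\in\mathbb N$ and equip $\mathbb R^n$ with the Euclidean norm. A *contact* $c$ on $\mathbb R^n$ is either *frictionless*, given by a normal row $J_{N,c}\in\mathbb R^{1\times n}$, or *frictional*, given by a normal row $J_{N,c}\in\mathbb R^{1\times n}$, a tangential matrix $J_{T,c}\in\mathbb R^{2\times n}$ and a friction coefficient $\mu_c>0$. A *contact set* $C$ is a finite set of contacts; $\mathcal C_{m,k}$ denotes the collection of contact sets with exactly $m$ contacts, exactly $k$ of which are frictional. Let $\mathrm{Unit}(w)=\{w/\|w\|_2\}$ for $w\neq 0$ and let $\mathrm{Unit}(0)$ be the closed unit ball of $\mathbb R^2$. Put $$F_c(v)=\{J_{N,c}^T\}\ \text{ ($c$ frictionless)},\qquad F_c(v)=J_{N,c}^T-\mu_c J_{T,c}^T\,\mathrm{Unit}(J_{T,c}v)\ \text{ ($c$ frictional)},$$ $$\mathcal A_C=\{v\in\mathbb R^n:\exists c\in C,\ J_{N,c}v<0\},\qquad \mathcal I_C=\mathrm{int}(\mathbb R^n\setminus\mathcal A_C),$$ $$F_C(v)=\mathrm{hull}\{f : \exists c\in C,\ v\in\mathrm{cl}\,\mathcal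 A_{\{c\}},\ f\in F_c(v)\},$$ and let $D_C(v)=\{0\}$ if $v\in\mathcal I_C$, $D_C(v)=F_C(v)$ if $v\in\mathcal A_C$, and $D_C(v)=\mathrm{hull}(\{0\}\cup F_C(v))$ otherwise. A solution of $\dot v\in D_C(v)$ on $[0,s]$ is an absolutely continuous $v:[0,s]\to\mathbb R^n$ with $\dot v(t)\in D_C(v(t))$ for almost every $t\in[0,s]$. A contact set $C$ is *nondegenerate* if $0\notin F_C(v)$ for every $v\in\mathcal A_C$. For a function $\beta:[0,\infty)\to[0,1)$ with $\beta(s)>0$ for all $s>0$, $C$ is *$\beta(s)$-dissipative* if for all $s>0$, every solution $v$ of $\dot v\in D_C(v)$ on $[0,s]$ with $v([0,s])\subseteq\mathcal A_C$ and $\|v(0)\|_2=1$ satisfies $\|v(s)\|_2\le 1-\beta(s)$. Call $C$ *dissipative* if it is $\beta(s)$-dissipative for some such $\beta$, which may depend on $C$. **Theorem (Dissipation Inductive Step).** Let $m,k\in\mathbb N$. Assume that for all $m'\ge k'\ge 0$ with $k'<k$, or with $k'=k$ and $m'<m$, every nondegenerate contact set in $\mathcal C_{m',k'}$ is dissipative.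 Then every nondegenerate contact set in $\mathcal C_{m,k}$ is dissipative. -/

import Mathlib

noncomputable section

namespace FrictionalImpact

/-- The velocity space `ℝⁿ` with its Euclidean norm. -/
abbrev Vel (n : ℕ) : Type := EuclideanSpace ℝ (Fin n)

/-- A contact on the velocity space `ℝⁿ`: either frictionless, given by its normal row `Jₙ`, or
frictional, given by its normal row `Jₙ`, its `2 × n` tangential Jacobian `Jₜ` (as a linear map
`ℝⁿ → ℝ²`) and its friction coefficient `μ > 0`. Row vectors are identified with vectors, so that
`Jₙ v` is the inner product of `Jₙ` and `v`, and `Jₙᵀ` is the vector `Jₙ`. -/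
inductive Contact (n : ℕ) : Type
  | frictionless (Jn : Vel n) : Contact n
  | frictional (Jn : Vel n) (Jt : Vel n →L[ℝ] EuclideanSpace ℝ (Fin 2)) (μ : ℝ) (hμ : 0 < μ) :
      Contact n

variable {n : ℕ}

/-- The normal row `Jₙ` of a contact. -/
def Contact.normal : Contact n → Vel n
  | .frictionless Jn => Jn
  | .frictional Jn _ _ _ => Jn

/-- Being one of the frictional contacts. -/
def Contact.IsFrictional : Contact n → Prop
  | .frictionless _ => False
  | .frictional _ _ _ _ => True

/-- The set-valued unit direction: `{w / ‖w‖}` for `w ≠ 0`, the closed unit ball for `w = 0`. -/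
def unitDir {d : ℕ} (w : EuclideanSpace ℝ (Fin d)) : Set (EuclideanSpace ℝ (Fin d)) :=
  {u | (w ≠ 0 ∧ u = ‖w‖⁻¹ • w) ∨ (w = 0 ∧ u ∈ Metric.closedBall 0 1)}

/-- The force increments of a single contact: `{Jₙᵀ}` without friction and
`Jₙᵀ - μ Jₜᵀ Unit(Jₜ v)` with friction. -/
def Contact.force (v : Vel n) : Contact n → Set (Vel n)
  | .frictionless Jn => {Jn}
  | .frictional Jn Jt μ _ =>
      (fun u => Jn - μ • ContinuousLinearMap.adjoint Jt u) '' unitDir (Jt v)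

/-- The active set of a contact set: velocities that penetrate at least one contact. -/
def activeSet (C : Finset (Contact n)) : Set (Vel n) :=
  {v | ∃ c ∈ C, inner ℝ c.normal v < 0}

/-- The inactive set of a contact set: the interior of the complement of the active set. -/
def inactiveSet (C : Finset (Contact n)) : Set (Vel n) :=
  interior (activeSet C)ᶜ

/-- The permissible net forces: the convex hull of the forces of all contacts `c` in the contact
set for which `v` lies in the closure of the active set of `{c}`. -/
def netForce (C : Finset (Contact n)) (v : Vel n) : Set (Vel n) :=
  convexHull ℝ {f | ∃ c ∈ C, v ∈ closure (activeSet {c}) ∧ f ∈ c.force v}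

open Classical in
/-- The set-valued right-hand side of the impact differential inclusion. -/
def derivativeMap (C : Finset (Contact n)) (v : Vel n) : Set (Vel n) :=
  if v ∈ inactiveSet C then {0}
  else if v ∈ activeSet C then netForce C v
  else convexHull ℝ ({0} ∪ netForce C v)

/-- Solutions of the differential inclusion `v' ∈ D v` on the interval `[a, b]`: absolutely
continuous functions whose derivative satisfies the inclusion almost everywhere on `[a, b]`.
Functions on `[a, b]` are represented by functions on `ℝ`; values outside `[a, b]` are
irrelevant. -/
def solutionSet (D : Vel n → Set (Vel n)) (a b : ℝ) : Set (ℝ → Vel n) :=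
  {v | AbsolutelyContinuousOnInterval v a b ∧
    ∀ᵐ t ∂(MeasureTheory.volume.restrict (Set.Icc a b)), ∃ v' ∈ D (v t), HasDerivAt v v' t}

/-- Positive definite functions from `[0, ∞)` to `[0, 1)`. -/
def IsDissipationRate (β : ℝ → ℝ) : Prop :=
  (∀ s, 0 ≤ s → β s ∈ Set.Ico (0 : ℝ) 1) ∧ ∀ s, 0 < s → 0 < β s

/-- The system `v' ∈ D_C(v)` is `β(s)`-dissipative. -/
def IsDissipativeWith (β : ℝ → ℝ) (C : Finset (Contact n)) : Prop :=
  ∀ s : ℝ, 0 < s → ∀ v ∈ solutionSet (derivativeMap C) 0 s,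
    v '' Set.Icc 0 s ⊆ activeSet C → ‖v 0‖ = 1 → ‖v s‖ ≤ 1 - β s

/-- The contact sets that are `β(s)`-dissipative for some rate `β` (which may depend on the
contact set). -/
def dissipativeSystems (n : ℕ) : Set (Finset (Contact n)) :=
  {C | ∃ β : ℝ → ℝ, IsDissipationRate β ∧ IsDissipativeWith β C}

/-- The nondegenerate contact sets: no penetrating velocity permits a zero net force. -/
def nondegenerateSystems (n : ℕ) : Set (Finset (Contact n)) :=
  {C | ∀ v ∈ activeSet C, (0 : Vel n) ∉ netForce C v}

open Classical in
/-- The sets of `m` contacts, exactly `k` of which are frictional. -/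
def sizedSystems (n m k : ℕ) : Set (Finset (Contact n)) :=
  {C | C.card = m ∧ (C.filter Contact.IsFrictional).card = k}

end FrictionalImpact

end

/-! Contact forces depend only on the direction of the velocity and never do positive work, and a
force doing no work at `v` comes from a contact whose rows both vanish on `v`. Suppose penetrating
trajectories of unit initial norm lose arbitrarily little norm over a fixed time. A limit solves the
same inclusion with constant norm, so only contacts vanishing on the velocity act. They also vanish
on its derivative at almost every time, so the derivative is orthogonal to itself and the limit is a
constant `v` (`eq_of_norm_eq_one`). Zero is then a net force at `v`, and nondegeneracy makes `v`
nonpenetrating.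

Such a `v` is excluded by looking at trajectories near it. Contacts that act there without vanishing
at `v` reduce the component along `v` at a definite rate; as little is lost, they act little. Hence
`x - v` is nearly a penetrating trajectory of the contacts vanishing at `v`, the error being
recorded by a defect `G` (`exists_localize`). A time bound linear in initial norm plus defect
(`HasTimeBound`) for this subsystem bounds a fixed time by a quantity tending to zero, a
contradiction (`exists_norm_le_of_hasTimeBound`).

The time bound is proved by induction on the number of contacts plus normals
(`IsNondegenerateOn.hasTimeBound`). After directions invisible to every contact and normal are
projected away, each unit vector has a strictly smaller subsystem. This yields uniform dissipation
at unit scale, and homogeneity turns it into a linear bound. With time bounds for all subsystems,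
the compactness argument on the whole space gives the dissipation rate. -/

namespace FrictionalImpact

open Set Filter Topology MeasureTheory
open scoped NNReal

variable {n : ℕ}

/-! ### Forces of a contact: homogeneity, work and invariance -/

/-- The tangential Jacobian of a contact, zero without friction. -/
def Contact.tangential : Contact n → (Vel n →L[ℝ] EuclideanSpace ℝ (Fin 2))
  | .frictionless _ => 0
  | .frictional _ Jt _ _ => Jt

/-- The friction coefficient of a contact, with an arbitrary positive value without friction. -/
def Contact.coeff : Contact n → ℝ
  | .frictionless _ => 1
  | .frictional _ _ μ _ => μ

theorem Contact.coeff_pos (c : Contact n) : 0 < c.coeff := by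
  cases c with
  | frictionless => exact one_pos
  | frictional _ _ _ h => exact h

theorem unitDir_zero {d : ℕ} :
    unitDir (0 : EuclideanSpace ℝ (Fin d)) = Metric.closedBall 0 1 := by
  ext; simp [unitDir]

theorem unitDir_of_ne_zero {d : ℕ} {w : EuclideanSpace ℝ (Fin d)} (hw : w ≠ 0) :
    unitDir w = {‖w‖⁻¹ • w} := by
  ext; simp [unitDir, hw]

theorem unitDir_subset_closedBall {d : ℕ} (w : EuclideanSpace ℝ (Fin d)) :
    unitDir w ⊆ Metric.closedBall 0 1 := by
  rcases eq_or_ne w 0 with rfl | hw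
  · rw [unitDir_zero]
  · rw [unitDir_of_ne_zero hw]
    simp [norm_smul, hw]

theorem convex_unitDir {d : ℕ} (w : EuclideanSpace ℝ (Fin d)) : Convex ℝ (unitDir w) := by
  rcases eq_or_ne w 0 with rfl | hw
  · rw [unitDir_zero]; exact convex_closedBall _ _
  · rw [unitDir_of_ne_zero hw]; exact convex_singleton _

theorem isCompact_unitDir {d : ℕ} (w : EuclideanSpace ℝ (Fin d)) : IsCompact (unitDir w) := by
  rcases eq_or_ne w 0 with rfl | hw
  · rw [unitDir_zero]; exact isCompact_closedBall _ _
  · rw [unitDir_of_ne_zero hw]; exact isCompact_singleton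

theorem inner_of_mem_unitDir {d : ℕ} {w u : EuclideanSpace ℝ (Fin d)} (hu : u ∈ unitDir w) :
    inner ℝ w u = ‖w‖ := by
  rcases eq_or_ne w 0 with rfl | hw
  · simp
  · rw [unitDir_of_ne_zero hw] at hu
    rw [mem_singleton_iff.1 hu, real_inner_smul_right, real_inner_self_eq_norm_sq]
    have : ‖w‖ ≠ 0 := norm_ne_zero_iff.2 hw
    field_simp

theorem unitDir_smul {d : ℕ} {r : ℝ} (hr : 0 < r) (w : EuclideanSpace ℝ (Fin d)) :
    unitDir (r • w) = unitDir w := by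
  rcases eq_or_ne w 0 with rfl | hw
  · simp
  · rw [unitDir_of_ne_zero hw, unitDir_of_ne_zero (smul_ne_zero hr.ne' hw), norm_smul,
      Real.norm_of_nonneg hr.le, smul_smul]
    congr 2
    field_simp

theorem Contact.force_eq (c : Contact n) (v : Vel n) :
    c.force v = (fun u => c.normal - c.coeff • ContinuousLinearMap.adjoint c.tangential u) ''
      unitDir (c.tangential v) := by
  cases c with
  | frictionless Jn =>
    simp only [Contact.force, Contact.normal, Contact.tangential, map_zero,
      zero_apply, smul_zero, sub_zero, unitDir_zero]
    rw [Set.Nonempty.image_const ⟨0, by simp⟩]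
  | frictional => rfl

/-- The contact does not act on `v` to first order: both its rows vanish on `v`. -/
def Contact.Vanishes (c : Contact n) (v : Vel n) : Prop :=
  inner ℝ c.normal v = 0 ∧ c.tangential v = 0

/-- The velocity `v` lies in the closure of the active set of the contact. -/
def Contact.Touches (c : Contact n) (v : Vel n) : Prop :=
  c.normal ≠ 0 ∧ inner ℝ c.normal v ≤ 0

/-- For a nonzero normal, subtracting a small positive multiple of it makes `v` strictly
penetrating; for a zero normal the active set is empty. -/
theorem Contact.mem_closure_activeSet (c : Contact n) (v : Vel n) :
    v ∈ closure (activeSet {c}) ↔ c.Touches v := by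
  have hA : activeSet {c} = {v | inner ℝ c.normal v < 0} := by
    ext; simp [activeSet]
  rw [hA]
  constructor
  · intro h
    refine ⟨?_, ?_⟩
    · intro h0
      simp [h0] at h
    · have hcl : IsClosed {v : Vel n | inner ℝ c.normal v ≤ 0} :=
        isClosed_le (by fun_prop) continuous_const
      have hsub : {v : Vel n | inner ℝ c.normal v < 0} ⊆ {v : Vel n | inner ℝ c.normal v ≤ 0} :=
        fun w (hw : inner ℝ c.normal w < 0) => hw.le
      exact closure_minimal hsub hcl h
  · rintro ⟨h0, h⟩
    have hpos : 0 < inner ℝ c.normal c.normal := real_inner_self_pos.2 h0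
    have ht : Tendsto (fun ε : ℝ => v - ε • c.normal) (𝓝[>] 0) (𝓝 v) := by
      have : Continuous (fun ε : ℝ => v - ε • c.normal) := by fun_prop
      have h2 := this.tendsto 0
      simp only [zero_smul, sub_zero] at h2
      exact h2.mono_left nhdsWithin_le_nhds
    refine mem_closure_of_tendsto ht ?_
    filter_upwards [self_mem_nhdsWithin] with ε hε
    have hε : 0 < ε := hε
    change inner ℝ c.normal (v - ε • c.normal) < 0
    rw [inner_sub_right, real_inner_smul_right]
    nlinarith [mul_pos hε hpos]

/-- The forces of the touching contacts, whose convex hull is the set of net forces. -/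
def generators (S : Finset (Contact n)) (v : Vel n) : Set (Vel n) :=
  {f | ∃ c ∈ S, c.Touches v ∧ f ∈ c.force v}

theorem netForce_eq (S : Finset (Contact n)) (v : Vel n) :
    netForce S v = convexHull ℝ (generators S v) := by
  simp only [netForce, generators, Contact.mem_closure_activeSet]

/-- Friction opposes sliding. For a touching contact both terms are nonpositive, so zero work forces
both rows to vanish. -/
theorem Contact.inner_of_mem_force {c : Contact n} {v f : Vel n} (hf : f ∈ c.force v) :
    inner ℝ v f = inner ℝ c.normal v - c.coeff * ‖c.tangential v‖ := by
  rw [c.force_eq] at hf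
  obtain ⟨u, hu, rfl⟩ := hf
  rw [inner_sub_right, real_inner_smul_right, ContinuousLinearMap.adjoint_inner_right,
    inner_of_mem_unitDir hu, real_inner_comm]

theorem Contact.Vanishes.inner_eq_zero {c : Contact n} {v w f : Vel n} (hw : c.Vanishes w)
    (hf : f ∈ c.force v) : inner ℝ w f = 0 := by
  rw [c.force_eq] at hf
  obtain ⟨u, hu, rfl⟩ := hf
  rw [inner_sub_right, real_inner_smul_right, ContinuousLinearMap.adjoint_inner_right,
    hw.2, real_inner_comm, hw.1]
  simp

theorem Contact.inner_nonpos {c : Contact n} {v f : Vel n} (hc : c.Touches v)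
    (hf : f ∈ c.force v) : inner ℝ v f ≤ 0 := by
  rw [Contact.inner_of_mem_force hf]
  nlinarith [hc.2, mul_nonneg c.coeff_pos.le (norm_nonneg (c.tangential v))]

theorem Contact.vanishes_of_inner_eq_zero {c : Contact n} {v f : Vel n} (hc : c.Touches v)
    (hf : f ∈ c.force v) (h : inner ℝ v f = 0) : c.Vanishes v := by
  rw [Contact.inner_of_mem_force hf] at h
  have h1 := mul_nonneg c.coeff_pos.le (norm_nonneg (c.tangential v))
  have h2 := hc.2
  refine ⟨by linarith, ?_⟩
  have : c.coeff * ‖c.tangential v‖ = 0 := by linarith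
  simpa [c.coeff_pos.ne'] using this

theorem Contact.Vanishes.force_add {c : Contact n} {w : Vel n} (hw : c.Vanishes w) (v : Vel n) :
    c.force (w + v) = c.force v := by
  rw [c.force_eq, c.force_eq, map_add, hw.2, zero_add]

theorem Contact.Vanishes.touches_add {c : Contact n} {w : Vel n} (hw : c.Vanishes w) (v : Vel n) :
    c.Touches (w + v) ↔ c.Touches v := by
  rw [Contact.Touches, Contact.Touches, inner_add_right, hw.1, zero_add]

theorem Contact.force_smul (c : Contact n) {r : ℝ} (hr : 0 < r) (v : Vel n) :
    c.force (r • v) = c.force v := by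
  rw [c.force_eq, c.force_eq, map_smul, unitDir_smul hr]

theorem Contact.touches_smul (c : Contact n) {r : ℝ} (hr : 0 < r) (v : Vel n) :
    c.Touches (r • v) ↔ c.Touches v := by
  rw [Contact.Touches, Contact.Touches, real_inner_smul_right, mul_nonpos_iff_pos_imp_nonpos]
  simp [hr, hr.le]

theorem generators_smul (S : Finset (Contact n)) {r : ℝ} (hr : 0 < r) (v : Vel n) :
    generators S (r • v) = generators S v := by
  simp only [generators, Contact.force_smul _ hr, Contact.touches_smul _ hr]

theorem generators_add_of_vanishes {S : Finset (Contact n)} {w : Vel n}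
    (hw : ∀ c ∈ S, c.Vanishes w) (v : Vel n) : generators S (w + v) = generators S v := by
  ext f
  refine exists_congr fun c => and_congr_right fun hc => ?_
  rw [(hw c hc).force_add, (hw c hc).touches_add]

/-! ### Bounds, compactness and semicontinuity of forces -/

/-- A bound for the forces of a contact. -/
noncomputable def Contact.bound (c : Contact n) : ℝ :=
  ‖c.normal‖ + c.coeff * ‖ContinuousLinearMap.adjoint c.tangential‖

theorem Contact.bound_nonneg (c : Contact n) : 0 ≤ c.bound := by
  have := c.coeff_pos
  unfold Contact.bound; positivity

theorem Contact.norm_le_bound {c : Contact n} {v f : Vel n} (hf : f ∈ c.force v) :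
    ‖f‖ ≤ c.bound := by
  rw [c.force_eq] at hf
  obtain ⟨u, hu, rfl⟩ := hf
  have hu1 : ‖u‖ ≤ 1 := by simpa using unitDir_subset_closedBall _ hu
  refine (norm_sub_le _ _).trans (add_le_add le_rfl ?_)
  rw [norm_smul, Real.norm_of_nonneg c.coeff_pos.le]
  refine mul_le_mul_of_nonneg_left ?_ c.coeff_pos.le
  refine (ContinuousLinearMap.le_opNorm _ _).trans ?_
  exact mul_le_of_le_one_right (norm_nonneg _) hu1

theorem exists_norm_le_of_mem_netForce (S : Finset (Contact n)) :
    ∃ B : ℝ, 0 ≤ B ∧ ∀ v, ∀ f ∈ netForce S v, ‖f‖ ≤ B := by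
  refine ⟨∑ c ∈ S, c.bound, Finset.sum_nonneg fun c _ => c.bound_nonneg, fun v f hf => ?_⟩
  rw [netForce_eq] at hf
  have : generators S v ⊆ Metric.closedBall 0 (∑ c ∈ S, c.bound) := by
    rintro f ⟨c, hc, -, hf⟩
    rw [mem_closedBall_zero_iff]
    exact (Contact.norm_le_bound hf).trans
      (Finset.single_le_sum (fun c _ => c.bound_nonneg) hc)
  simpa using convexHull_min this (convex_closedBall _ _) hf

theorem Contact.convex_force (c : Contact n) (v : Vel n) : Convex ℝ (c.force v) := by
  rw [c.force_eq]
  rintro _ ⟨u, hu, rfl⟩ _ ⟨w, hw, rfl⟩ a b ha hb hab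
  refine ⟨a • u + b • w, convex_unitDir _ hu hw ha hb hab, ?_⟩
  simp only [map_add, map_smul]
  calc c.normal - c.coeff • (a • ContinuousLinearMap.adjoint c.tangential u +
        b • ContinuousLinearMap.adjoint c.tangential w)
      = (a + b) • c.normal - c.coeff • (a • ContinuousLinearMap.adjoint c.tangential u +
        b • ContinuousLinearMap.adjoint c.tangential w) := by rw [hab, one_smul]
    _ = _ := by module

theorem Contact.isCompact_force (c : Contact n) (v : Vel n) : IsCompact (c.force v) := by
  rw [c.force_eq]
  exact (isCompact_unitDir _).image (by fun_prop)

theorem isCompact_convexHull_union {E : Type*} [AddCommGroup E] [Module ℝ E] [TopologicalSpace E]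
    [IsTopologicalAddGroup E] [ContinuousSMul ℝ E] {s t : Set E}
    (hs : IsCompact (convexHull ℝ s)) (ht : IsCompact (convexHull ℝ t)) :
    IsCompact (convexHull ℝ (s ∪ t)) := by
  rcases s.eq_empty_or_nonempty with rfl | hs0
  · simpa using ht
  rcases t.eq_empty_or_nonempty with rfl | ht0
  · simpa using hs
  rw [convexHull_union hs0 ht0]
  have : convexJoin ℝ (convexHull ℝ s) (convexHull ℝ t) =
      (fun p : ℝ × E × E => (1 - p.1) • p.2.1 + p.1 • p.2.2) ''
        (Icc 0 1 ×ˢ (convexHull ℝ s ×ˢ convexHull ℝ t)) := by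
    ext x
    simp only [mem_convexJoin, segment_eq_image, mem_image, mem_prod, Prod.exists]
    constructor
    · rintro ⟨a, ha, b, hb, θ, hθ, rfl⟩
      exact ⟨θ, a, b, ⟨hθ, ha, hb⟩, rfl⟩
    · rintro ⟨θ, a, b, ⟨hθ, ha, hb⟩, rfl⟩
      exact ⟨a, ha, b, hb, θ, hθ, rfl⟩
  rw [this]
  exact (isCompact_Icc.prod (hs.prod ht)).image (by fun_prop)

theorem isCompact_netForce (S : Finset (Contact n)) (v : Vel n) : IsCompact (netForce S v) := by
  classical
  rw [netForce_eq]
  induction S using Finset.induction_on with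
  | empty => simp [generators]
  | insert c S _ ih =>
    have : generators (insert c S) v = {f | c.Touches v ∧ f ∈ c.force v} ∪ generators S v := by
      ext f; simp [generators]
    rw [this]
    refine isCompact_convexHull_union ?_ ih
    by_cases h : c.Touches v
    · simpa [h, (c.convex_force v).convexHull_eq] using c.isCompact_force v
    · simp [h]

theorem Contact.eventually_touches {c : Contact n} {v₀ : Vel n} :
    ∀ᶠ v in 𝓝 v₀, c.Touches v → c.Touches v₀ := by
  by_cases h : inner ℝ c.normal v₀ ≤ 0
  · exact Eventually.of_forall fun v hv => ⟨hv.1, h⟩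
  · have : ∀ᶠ v in 𝓝 v₀, 0 < inner ℝ c.normal v :=
      (Continuous.tendsto (by fun_prop) v₀).eventually_const_lt (not_le.1 h)
    filter_upwards [this] with v hv hv'
    exact absurd hv'.2 (not_le.2 hv)

/-- Upper semicontinuity, tested on linear functionals: the unit direction is continuous away from
zero, and at zero its value is the ball containing all nearby values. -/
theorem Contact.eventually_force_lt {c : Contact n} {v₀ : Vel n} (l : Vel n →L[ℝ] ℝ) {u : ℝ}
    (h : ∀ f ∈ c.force v₀, l f < u) : ∀ᶠ v in 𝓝 v₀, ∀ f ∈ c.force v, l f < u := by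
  by_cases h0 : c.tangential v₀ = 0
  · refine Eventually.of_forall fun v f hf => h f ?_
    rw [c.force_eq] at hf ⊢
    rw [h0, unitDir_zero]
    exact image_mono (unitDir_subset_closedBall _) hf
  · have hne : ∀ᶠ v in 𝓝 v₀, c.tangential v ≠ 0 :=
      c.tangential.continuous.continuousAt.eventually_ne h0
    have hcont : ContinuousAt (fun v => l (c.normal - c.coeff •
        ContinuousLinearMap.adjoint c.tangential (‖c.tangential v‖⁻¹ • c.tangential v))) v₀ := by
      have h1 : ContinuousAt (fun v => ‖c.tangential v‖⁻¹ • c.tangential v) v₀ := by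
        have h2 : ContinuousAt (fun v => ‖c.tangential v‖) v₀ := by fun_prop
        have h3 : ContinuousAt (fun v => c.tangential v) v₀ := by fun_prop
        exact (h2.inv₀ (norm_ne_zero_iff.2 h0)).smul h3
      fun_prop
    have hlt : l (c.normal - c.coeff •
        ContinuousLinearMap.adjoint c.tangential (‖c.tangential v₀‖⁻¹ • c.tangential v₀)) < u := by
      refine h _ ?_
      rw [c.force_eq, unitDir_of_ne_zero h0]
      exact ⟨_, rfl, rfl⟩
    filter_upwards [hne, hcont.eventually_lt_const hlt] with v hv hv' f hf
    rw [c.force_eq, unitDir_of_ne_zero hv, image_singleton, mem_singleton_iff] at hf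
    rwa [hf]

theorem eventually_generators_lt {S : Finset (Contact n)} {v₀ : Vel n} (l : Vel n →L[ℝ] ℝ) {u : ℝ}
    (h : ∀ f ∈ generators S v₀, l f < u) : ∀ᶠ v in 𝓝 v₀, ∀ f ∈ generators S v, l f < u := by
  have : ∀ c ∈ S, ∀ᶠ v in 𝓝 v₀, c.Touches v → ∀ f ∈ c.force v, l f < u := by
    intro c hc
    by_cases ht : c.Touches v₀
    · exact (Contact.eventually_force_lt l fun f hf => h f ⟨c, hc, ht, hf⟩).mono
        fun v hv _ => hv
    · exact Contact.eventually_touches.mono fun v hv hv' => absurd (hv hv') ht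
  filter_upwards [(eventually_all_finset S).2 this] with v hv
  rintro f ⟨c, hc, ht, hf⟩
  exact hv c hc ht f hf

/-- Near a velocity at which a contact is not penetrated, the forces of the contact either
dissipate at a definite rate or come from a contact that vanishes at that velocity. -/
theorem Contact.eventually_dissipates {c : Contact n} {v₀ : Vel n} (h₀ : 0 ≤ inner ℝ c.normal v₀) :
    ∃ C : ℝ, 0 ≤ C ∧ ∀ᶠ v in 𝓝 v₀, c.Touches v → ∀ f ∈ c.force v,
      c.Vanishes v₀ ∨ 1 + ‖f‖ ≤ -(C * inner ℝ v₀ f) := by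
  by_cases hv : c.Vanishes v₀
  · exact ⟨0, le_rfl, Eventually.of_forall fun v _ f _ => Or.inl hv⟩
  by_cases ht : c.Touches v₀
  · have hn : inner ℝ c.normal v₀ = 0 := le_antisymm ht.2 h₀
    have htan : 0 < ‖c.tangential v₀‖ := norm_pos_iff.2 fun h => hv ⟨hn, h⟩
    -- At `v₀` only friction does work, namely `-2 * δ`; at least half of it survives nearby.
    set δ := c.coeff * ‖c.tangential v₀‖ / 2 with hδ
    have hδ0 : 0 < δ := by have := mul_pos c.coeff_pos htan; rw [hδ]; linarith
    have := Contact.eventually_force_lt (c := c) (v₀ := v₀) (innerSL ℝ v₀) (u := -δ) (by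
      intro f hf
      rw [innerSL_apply_apply, Contact.inner_of_mem_force hf, hn]
      linarith)
    refine ⟨(1 + c.bound) / δ, by have := c.bound_nonneg; positivity, ?_⟩
    filter_upwards [this] with v hv _ f hf
    right
    have h1 := hv f hf
    rw [innerSL_apply_apply] at h1
    have h2 := c.bound_nonneg
    calc 1 + ‖f‖ ≤ 1 + c.bound := by linarith [Contact.norm_le_bound hf]
      _ = (1 + c.bound) / δ * δ := by field_simp
      _ ≤ (1 + c.bound) / δ * (-inner ℝ v₀ f) :=
        mul_le_mul_of_nonneg_left (by linarith) (by positivity)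
      _ = _ := by ring
  · exact ⟨0, le_rfl, Contact.eventually_touches.mono fun v hv hv' => absurd (hv hv') ht⟩

theorem exists_eventually_dissipates {S : Finset (Contact n)} {v₀ : Vel n}
    (h₀ : ∀ c ∈ S, 0 ≤ inner ℝ c.normal v₀) :
    ∃ C : ℝ, 0 ≤ C ∧ ∀ᶠ v in 𝓝 v₀, ∀ c ∈ S, c.Touches v → ∀ f ∈ c.force v,
      c.Vanishes v₀ ∨ 1 + ‖f‖ ≤ -(C * inner ℝ v₀ f) := by
  have h : ∀ c : Contact n, ∃ C : ℝ, c ∈ S → 0 ≤ C ∧ ∀ᶠ v in 𝓝 v₀, c.Touches v →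
      ∀ f ∈ c.force v, c.Vanishes v₀ ∨ 1 + ‖f‖ ≤ -(C * inner ℝ v₀ f) := by
    intro c
    by_cases hc : c ∈ S
    · obtain ⟨C, hC⟩ := Contact.eventually_dissipates (h₀ c hc)
      exact ⟨C, fun _ => hC⟩
    · exact ⟨0, fun h => absurd h hc⟩
  choose C hC using h
  refine ⟨∑ c ∈ S, C c, Finset.sum_nonneg fun c hc => (hC c hc).1, ?_⟩
  refine (eventually_all_finset S).2 fun c hc => ?_
  filter_upwards [(hC c hc).2] with v hv ht f hf
  refine (hv ht f hf).imp_right fun h => h.trans ?_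
  have h1 : C c ≤ ∑ c ∈ S, C c := Finset.single_le_sum (fun c hc => (hC c hc).1) hc
  -- Positivity of `1 + ‖f‖` forces this sign, which permits enlarging `C c` to the sum.
  have h2 : inner ℝ v₀ f ≤ 0 := by
    by_contra h3
    have := mul_nonneg (hC c hc).1 (not_le.1 h3).le
    linarith [norm_nonneg f]
  nlinarith

/-! ### Calculus with almost everywhere derivatives -/

theorem sub_le_of_ae_deriv_le {φ : ℝ → ℝ} {a b c : ℝ} (hab : a ≤ b)
    (hφ : AbsolutelyContinuousOnInterval φ a b)
    (h : ∀ᵐ t, t ∈ Ioo a b → ∃ d, HasDerivAt φ d t ∧ d ≤ c) :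
    φ b - φ a ≤ c * (b - a) := by
  rw [← hφ.integral_deriv_eq_sub]
  have hle : deriv φ ≤ᵐ[volume.restrict (Icc a b)] fun _ => c := by
    rw [Measure.restrict_congr_set Ioo_ae_eq_Icc.symm]
    filter_upwards [ae_restrict_of_ae h, ae_restrict_mem measurableSet_Ioo] with t ht hm
    obtain ⟨d, hd, hdc⟩ := ht hm
    rwa [hd.deriv]
  calc ∫ t in a..b, deriv φ t ≤ ∫ _ in a..b, c :=
        intervalIntegral.integral_mono_ae_restrict hab hφ.intervalIntegrable_deriv
          intervalIntegrable_const hle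
    _ = c * (b - a) := by simp [mul_comm]

theorem sub_le_of_lipschitzWith_of_ae_deriv_le {φ : ℝ → ℝ} {K : ℝ≥0} {a b c : ℝ} (hab : a ≤ b)
    (hφ : LipschitzWith K φ)
    (h : ∀ᵐ t, t ∈ Ioo a b → ∃ d, HasDerivAt φ d t ∧ d ≤ c) :
    φ b - φ a ≤ c * (b - a) :=
  sub_le_of_ae_deriv_le hab
    (hφ.lipschitzOnWith (s := uIcc a b)).absolutelyContinuousOnInterval h

/-- At almost every zero of a function of a real variable its derivative vanishes. -/
theorem ae_hasDerivAt_eq_zero_of_eq_zero {W : Type*} [NormedAddCommGroup W] [NormedSpace ℝ W]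
    (φ : ℝ → W) : ∀ᵐ t : ℝ, φ t = 0 → ∀ d, HasDerivAt φ d t → d = 0 := by
  -- Zeros isolated from the right are countable; at any other zero, difference quotients along
  -- zeros to its right vanish.
  have hc := (countable_setOfPred_isolated_right_within (s := {t : ℝ | φ t = 0})).ae_notMem volume
  filter_upwards [hc] with t ht h0 d hd
  have hne : (𝓝[{t : ℝ | φ t = 0} ∩ Ioi t] t).NeBot := ⟨fun h => ht ⟨h0, h⟩⟩
  have hslope : Tendsto (slope φ t) (𝓝[{t : ℝ | φ t = 0} ∩ Ioi t] t) (𝓝 d) := by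
    refine (hasDerivAt_iff_tendsto_slope.1 hd).mono_left (nhdsWithin_mono _ ?_)
    rintro s ⟨-, hs⟩
    exact ne_of_gt hs
  refine tendsto_nhds_unique hslope (tendsto_const_nhds.congr' ?_)
  filter_upwards [self_mem_nhdsWithin] with s hs
  have hs0 : φ s = 0 := hs.1
  rw [slope_def_module, hs0, h0, sub_zero, smul_zero]

theorem le_of_hasDerivAt_of_forall_sub_le {φ : ℝ → ℝ} {t d u η : ℝ} (hd : HasDerivAt φ d t)
    (hη : 0 < η) (h : ∀ s ∈ Ioo t (t + η), φ s - φ t ≤ u * (s - t)) : d ≤ u := by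
  have h1 : Tendsto (slope φ t) (𝓝[>] t) (𝓝 d) :=
    (hasDerivAt_iff_tendsto_slope.1 hd).mono_left
      (nhdsWithin_mono _ fun s (hs : t < s) => ne_of_gt hs)
  refine le_of_tendsto h1 ?_
  filter_upwards [Ioo_mem_nhdsGT (show t < t + η by linarith)] with s hs
  rw [slope_def_field, div_le_iff₀ (by linarith [hs.1])]
  exact h s hs

/-! ### Perturbed forces and trajectories with defect -/

/-- The velocities with a negative component along one of the given normals. -/
def penetrating (A : Finset (Vel n)) : Set (Vel n) :=
  {v | ∃ a ∈ A, inner ℝ a v < 0}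

/-- Pairs of a net force and a bound for its defect: convex combinations of forces without defect
and of arbitrary vectors `e` with a defect of at least `1 + ‖e‖`. -/
def perturbedForce (S : Finset (Contact n)) (v : Vel n) : Set (Vel n × ℝ) :=
  convexHull ℝ ({p | p.1 ∈ generators S v ∧ p.2 = 0} ∪ {p | 1 + ‖p.1‖ ≤ p.2})

theorem perturbedForce_induction {S : Finset (Contact n)} {v : Vel n} {K : Set (Vel n × ℝ)}
    (hK : Convex ℝ K) (h1 : ∀ f ∈ generators S v, (f, (0 : ℝ)) ∈ K)
    (h2 : ∀ e h, 1 + ‖e‖ ≤ h → (e, h) ∈ K) : perturbedForce S v ⊆ K := by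
  refine convexHull_min ?_ hK
  rintro ⟨f, h⟩ (⟨hf, h0⟩ | hp)
  · obtain rfl : h = 0 := h0
    exact h1 f hf
  · exact h2 _ _ hp

theorem mem_perturbedForce_of_generator {S : Finset (Contact n)} {v f : Vel n}
    (hf : f ∈ generators S v) : (f, (0 : ℝ)) ∈ perturbedForce S v :=
  subset_convexHull ℝ _ (Or.inl ⟨hf, rfl⟩)

theorem mem_perturbedForce_of_le {S : Finset (Contact n)} {v e : Vel n} {h : ℝ}
    (he : 1 + ‖e‖ ≤ h) : (e, h) ∈ perturbedForce S v :=
  subset_convexHull ℝ _ (Or.inr he)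

theorem mem_perturbedForce_of_netForce {S : Finset (Contact n)} {v f : Vel n}
    (hf : f ∈ netForce S v) : (f, (0 : ℝ)) ∈ perturbedForce S v := by
  rw [netForce_eq] at hf
  have hc : Convex ℝ {f : Vel n | (f, (0 : ℝ)) ∈ perturbedForce S v} := by
    intro f hf g hg a b ha hb hab
    have := convex_convexHull ℝ _ hf hg ha hb hab
    simpa [perturbedForce] using this
  exact convexHull_min (fun f hf => mem_perturbedForce_of_generator hf) hc hf

theorem map_mem_perturbedForce {S S' : Finset (Contact n)} {v v' : Vel n}
    (Λ : Vel n × ℝ →ₗ[ℝ] Vel n × ℝ)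
    (h1 : ∀ f ∈ generators S v, Λ (f, 0) ∈ perturbedForce S' v')
    (h2 : ∀ e h, 1 + ‖e‖ ≤ h → Λ (e, h) ∈ perturbedForce S' v')
    {p : Vel n × ℝ} (hp : p ∈ perturbedForce S v) : Λ p ∈ perturbedForce S' v' :=
  perturbedForce_induction (K := Λ ⁻¹' perturbedForce S' v')
    ((convex_convexHull ℝ _).linear_preimage Λ) h1 h2 hp

/-- A linear functional of the net force is controlled by its values on the generators and by the
defect. -/
theorem apply_le_of_mem_perturbedForce {S : Finset (Contact n)} {v : Vel n} (l : Vel n →L[ℝ] ℝ)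
    {u : ℝ} (h : ∀ f ∈ generators S v, l f ≤ u) {p : Vel n × ℝ} (hp : p ∈ perturbedForce S v) :
    l p.1 ≤ u + (|u| + ‖l‖) * p.2 := by
  have hc : Convex ℝ {p : Vel n × ℝ | l p.1 - (|u| + ‖l‖) * p.2 ≤ u} := by
    refine convex_halfSpace_le ⟨fun x y => ?_, fun c x => ?_⟩ u
    · simp only [Prod.fst_add, Prod.snd_add, map_add]; ring
    · simp only [Prod.smul_fst, Prod.smul_snd, map_smul, smul_eq_mul]; ring
  have := perturbedForce_induction (K := {p : Vel n × ℝ | l p.1 - (|u| + ‖l‖) * p.2 ≤ u}) hc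
    (fun f hf => by simpa using h f hf) (fun e g heg => ?_) hp
  · have h3 : l p.1 - (|u| + ‖l‖) * p.2 ≤ u := this
    linarith
  · change l e - (|u| + ‖l‖) * g ≤ u
    -- In `1 + ‖e‖ ≤ g`, the summand `1` pays for `|u|` when `u` is negative, and `‖e‖` pays for `l
    -- e`.
    have h1 : l e ≤ ‖l‖ * ‖e‖ := (le_abs_self _).trans (l.le_opNorm e)
    have h2 : 0 ≤ ‖l‖ := norm_nonneg _
    have h3 : 0 ≤ ‖e‖ := norm_nonneg _
    have h4 : 0 ≤ |u| := abs_nonneg _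
    have h5 := neg_abs_le u
    nlinarith [mul_le_mul_of_nonneg_left heg h2, mul_le_mul_of_nonneg_left heg h4,
      mul_nonneg h4 h3]

theorem nonneg_of_mem_perturbedForce {S : Finset (Contact n)} {v : Vel n} {p : Vel n × ℝ}
    (hp : p ∈ perturbedForce S v) : 0 ≤ p.2 := by
  have hc : Convex ℝ {p : Vel n × ℝ | 0 ≤ p.2} :=
    convex_halfSpace_ge (LinearMap.snd ℝ (Vel n) ℝ).isLinear 0
  exact perturbedForce_induction hc (fun f _ => le_refl (0 : ℝ))
    (fun e g heg => le_trans (by positivity) heg) hp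

theorem inner_le_of_mem_perturbedForce {S : Finset (Contact n)} {v : Vel n} {p : Vel n × ℝ}
    (hp : p ∈ perturbedForce S v) : inner ℝ v p.1 ≤ ‖v‖ * p.2 := by
  have := apply_le_of_mem_perturbedForce (innerSL ℝ v) (u := 0) (by
    rintro f ⟨c, _, ht, hf⟩
    exact Contact.inner_nonpos ht hf) hp
  simpa using this

/-- Lipschitz trajectories `x` of the impact dynamics on `[0, T]` that stay in a penetrating set,
where `G` bounds the accumulated defect of the forces. -/
structure IsTrajectory (S : Finset (Contact n)) (A : Finset (Vel n)) (M : ℝ≥0) (T : ℝ)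
    (x : ℝ → Vel n) (G : ℝ → ℝ) : Prop where
  lipschitz : LipschitzWith M x
  lipschitz_defect : LipschitzWith M G
  mem : ∀ t ∈ Icc 0 T, x t ∈ penetrating A
  ae_mem : ∀ᵐ t, t ∈ Ioo 0 T → ∃ p : Vel n × ℝ, p ∈ perturbedForce S (x t) ∧
    HasDerivAt x p.1 t ∧ HasDerivAt G p.2 t

theorem ne_zero_of_mem_penetrating {A : Finset (Vel n)} {v : Vel n} (h : v ∈ penetrating A) :
    v ≠ 0 := by
  rintro rfl
  obtain ⟨a, -, ha⟩ := h
  simp at ha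

namespace IsTrajectory

variable {S : Finset (Contact n)} {A : Finset (Vel n)} {M : ℝ≥0} {T : ℝ} {x : ℝ → Vel n}
  {G : ℝ → ℝ}

theorem defect_mono (h : IsTrajectory S A M T x G) {a b : ℝ} (ha : 0 ≤ a) (hab : a ≤ b)
    (hb : b ≤ T) : G a ≤ G b := by
  have := sub_le_of_lipschitzWith_of_ae_deriv_le (φ := fun t => -G t) (c := 0) hab
    h.lipschitz_defect.neg (by
      filter_upwards [h.ae_mem] with t ht hm
      obtain ⟨p, hp, -, hG⟩ := ht ⟨ha.trans_lt hm.1, hm.2.trans_le hb⟩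
      exact ⟨_, hG.neg, neg_nonpos.2 (nonneg_of_mem_perturbedForce hp)⟩)
  linarith

/-- Forces without defect do no positive work, so only the defect can increase the norm. The norm is
differentiable along the trajectory because penetrating velocities are nonzero. -/
theorem norm_sub_le (h : IsTrajectory S A M T x G) {a b : ℝ} (ha : 0 ≤ a) (hab : a ≤ b)
    (hb : b ≤ T) : ‖x b‖ - ‖x a‖ ≤ G b - G a := by
  have hlip : LipschitzWith (M + M) (fun t => ‖x t‖ - G t) := by
    have h1 : LipschitzWith (1 * M) (fun t => ‖x t‖) := lipschitzWith_one_norm.comp h.lipschitz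
    rw [one_mul] at h1
    exact h1.sub h.lipschitz_defect
  have := sub_le_of_lipschitzWith_of_ae_deriv_le (c := 0) hab hlip (by
      filter_upwards [h.ae_mem] with t ht hm
      have hm' : t ∈ Ioo 0 T := ⟨ha.trans_lt hm.1, hm.2.trans_le hb⟩
      obtain ⟨p, hp, hx, hG⟩ := ht hm'
      have hne := ne_zero_of_mem_penetrating (h.mem t (Ioo_subset_Icc_self hm'))
      have hpos : 0 < ‖x t‖ := norm_pos_iff.2 hne
      have hsq := hx.norm_sq.sqrt (by positivity)
      simp only [Real.sqrt_sq (norm_nonneg _)] at hsq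
      refine ⟨_, hsq.sub hG, ?_⟩
      have h2 := inner_le_of_mem_perturbedForce hp
      have h3 : 2 * inner ℝ (x t) p.1 / (2 * ‖x t‖) ≤ p.2 := by
        rw [div_le_iff₀ (by positivity)]; nlinarith
      linarith)
  linarith

/-- Restriction to a subinterval, with the origin of time moved to its start, followed by the
positive rescaling that leaves velocities of the dynamics unchanged. -/
theorem rescale (h : IsTrajectory S A M T x G) {a r L : ℝ} (ha : 0 ≤ a) (hr : 0 < r)
    (hL : a + r * L ≤ T) :
    IsTrajectory S A M L (fun t => r⁻¹ • x (a + r * t)) (fun t => r⁻¹ * G (a + r * t)) := by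
  have hdist : ∀ s t : ℝ, dist (a + r * s) (a + r * t) = r * dist s t := fun s t => by
    rw [dist_add_left, Real.dist_eq, Real.dist_eq, ← mul_sub, abs_mul, abs_of_pos hr]
  have hmaps : ∀ t ∈ Icc 0 L, a + r * t ∈ Icc 0 T := fun t ht =>
    ⟨by have := mul_nonneg hr.le ht.1; linarith,
      by have := mul_le_mul_of_nonneg_left ht.2 hr.le; linarith⟩
  have hmaps' : ∀ t ∈ Ioo 0 L, a + r * t ∈ Ioo 0 T := fun t ht =>
    ⟨by have := mul_pos hr ht.1; linarith,
      by have := mul_lt_mul_of_pos_left ht.2 hr; linarith⟩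
  refine ⟨?_, ?_, ?_, ?_⟩
  · refine LipschitzWith.of_dist_le_mul fun s t => ?_
    rw [dist_smul₀, Real.norm_of_nonneg (inv_nonneg.2 hr.le)]
    calc r⁻¹ * dist (x (a + r * s)) (x (a + r * t)) ≤ r⁻¹ * (M * (r * dist s t)) := by
          rw [← hdist]
          exact mul_le_mul_of_nonneg_left (h.lipschitz.dist_le_mul _ _) (inv_nonneg.2 hr.le)
      _ = M * dist s t := by field_simp
  · refine LipschitzWith.of_dist_le_mul fun s t => ?_
    rw [← smul_eq_mul r⁻¹, ← smul_eq_mul r⁻¹, dist_smul₀, Real.norm_of_nonneg (inv_nonneg.2 hr.le)]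
    calc r⁻¹ * dist (G (a + r * s)) (G (a + r * t)) ≤ r⁻¹ * (M * (r * dist s t)) := by
          rw [← hdist]
          exact mul_le_mul_of_nonneg_left (h.lipschitz_defect.dist_le_mul _ _) (inv_nonneg.2 hr.le)
      _ = M * dist s t := by field_simp
  · intro t ht
    obtain ⟨b, hb, hneg⟩ := h.mem _ (hmaps t ht)
    exact ⟨b, hb, by
      rw [real_inner_smul_right]; exact mul_neg_of_pos_of_neg (inv_pos.2 hr) hneg⟩
  · have hqmp : Measure.QuasiMeasurePreserving (fun t : ℝ => a + r * t) volume volume := by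
      refine ⟨by fun_prop, ?_⟩
      have h1 : Measure.map (fun t : ℝ => a + r * t) volume =
          Measure.map (fun t => a + t) (Measure.map (fun t => r * t) volume) := by
        rw [Measure.map_map (by fun_prop) (by fun_prop)]; rfl
      rw [h1, Real.map_volume_mul_left hr.ne', Measure.map_smul,
        (measurePreserving_add_left volume a).map_eq]
      exact Measure.smul_absolutelyContinuous
    filter_upwards [hqmp.ae h.ae_mem] with t ht hm
    obtain ⟨p, hp, hx, hG⟩ := ht (hmaps' t hm)
    have haff : HasDerivAt (fun t : ℝ => a + r * t) r t := by
      simpa using ((hasDerivAt_id t).const_mul r).const_add a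
    refine ⟨p, ?_, ?_, ?_⟩
    · unfold perturbedForce
      rwa [generators_smul _ (inv_pos.2 hr)]
    · have := (hx.scomp t haff).const_smul r⁻¹
      rwa [smul_smul, inv_mul_cancel₀ hr.ne', one_smul] at this
    · have := (hG.scomp t haff).const_mul r⁻¹
      rwa [smul_eq_mul, ← mul_assoc, inv_mul_cancel₀ hr.ne', one_mul] at this

theorem restrict (h : IsTrajectory S A M T x G) {L : ℝ} (hL : L ≤ T) :
    IsTrajectory S A M L x G := by
  simpa using h.rescale (a := 0) (r := 1) (L := L) le_rfl one_pos (by simpa using hL)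

/-- Velocity components that the contacts do not see may be projected away. -/
theorem project (h : IsTrajectory S A M T x G) {N : Submodule ℝ (Vel n)}
    (hS : ∀ v ∈ N, ∀ c ∈ S, c.Vanishes v) (hA : ∀ v ∈ N, ∀ a ∈ A, inner ℝ a v = 0) :
    IsTrajectory S A M T (fun t => Nᗮ.starProjection (x t)) G := by
  have hdec : ∀ v : Vel n, ∃ w ∈ N, v = w + Nᗮ.starProjection v := fun v =>
    ⟨N.starProjection v, Submodule.starProjection_apply_mem _ _,
      (N.starProjection_add_starProjection_orthogonal v).symm⟩
  refine ⟨?_, h.lipschitz_defect, ?_, ?_⟩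
  · refine LipschitzWith.of_dist_le_mul fun s t => ?_
    refine le_trans ?_ (h.lipschitz.dist_le_mul s t)
    rw [dist_eq_norm, dist_eq_norm, ← map_sub]
    exact Nᗮ.norm_starProjection_apply_le _
  · intro t ht
    obtain ⟨a, ha, hneg⟩ := h.mem t ht
    obtain ⟨w, hw, hv⟩ := hdec (x t)
    rw [hv, inner_add_right, hA w hw a ha, zero_add] at hneg
    exact ⟨a, ha, hneg⟩
  · filter_upwards [h.ae_mem] with t ht hm
    obtain ⟨p, hp, hx, hG⟩ := ht hm
    refine ⟨(Nᗮ.starProjection p.1, p.2), ?_, ?_, hG⟩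
    · refine map_mem_perturbedForce (S := S) (v := x t)
        (LinearMap.prodMap (Nᗮ.starProjection : Vel n →ₗ[ℝ] Vel n) LinearMap.id) ?_ ?_ hp
      -- Generators are orthogonal to `N` and unchanged when the `N`-component of the velocity is
      -- removed.
      · intro f hf
        have hf' : f ∈ Nᗮ := by
          rw [Submodule.mem_orthogonal]
          intro v hv
          obtain ⟨c, hc, -, hf⟩ := hf
          exact (hS v hv c hc).inner_eq_zero hf
        have hpf : Nᗮ.starProjection f = f := Submodule.starProjection_eq_self_iff.2 hf'
        obtain ⟨w, hw, hv⟩ := hdec (x t)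
        rw [hv, generators_add_of_vanishes (hS w hw)] at hf
        simpa [hpf] using mem_perturbedForce_of_generator hf
      · intro e g heg
        refine mem_perturbedForce_of_le ?_
        have := Nᗮ.norm_starProjection_apply_le e
        exact (add_le_add le_rfl this).trans heg
    · exact (Nᗮ.starProjection.hasFDerivAt.comp_hasDerivAt t hx)

end IsTrajectory

/-! ### Subsystems at a velocity and localization -/

open Classical in
/-- The contacts that vanish at a velocity. -/
noncomputable def vanishingContacts (S : Finset (Contact n)) (v : Vel n) : Finset (Contact n) :=
  S.filter fun c => c.Vanishes v

open Classical in
/-- The normals orthogonal to a velocity. -/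
noncomputable def vanishingNormals (A : Finset (Vel n)) (v : Vel n) : Finset (Vel n) :=
  A.filter fun a => inner ℝ a v = 0

/-- No penetrating velocity permits a zero net force, for a penetrating set that may be larger
than the active set of the contacts. -/
structure IsNondegenerateOn (S : Finset (Contact n)) (A : Finset (Vel n)) : Prop where
  normal_mem : ∀ c ∈ S, c.normal ∈ A
  zero_notMem : ∀ v ∈ penetrating A, (0 : Vel n) ∉ netForce S v

/-- A linear bound for the time that trajectories can stay in the penetrating set. -/
def HasTimeBound (S : Finset (Contact n)) (A : Finset (Vel n)) : Prop :=
  ∀ M : ℝ≥0, ∃ K : ℝ, 0 ≤ K ∧ ∀ T, 0 ≤ T → ∀ x G, IsTrajectory S A M T x G →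
    T ≤ K * (‖x 0‖ + (G T - G 0))

/-- Adding `v` changes nothing for contacts that vanish at `v`, so a degenerate `w` of the subsystem
would make `v + w` degenerate for the whole. Normals are tracked separately because a contact may
leave through its tangential row while its normal, orthogonal to `v`, still defines penetration. -/
theorem IsNondegenerateOn.vanishing {S : Finset (Contact n)} {A : Finset (Vel n)}
    (h : IsNondegenerateOn S A) (v : Vel n) :
    IsNondegenerateOn (vanishingContacts S v) (vanishingNormals A v) := by
  classical
  refine ⟨fun c hc => ?_, fun w hw h0 => ?_⟩
  · obtain ⟨hc, hv⟩ := Finset.mem_filter.1 hc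
    exact Finset.mem_filter.2 ⟨h.normal_mem c hc, hv.1⟩
  · obtain ⟨a, ha, hneg⟩ := hw
    obtain ⟨ha, hav⟩ := Finset.mem_filter.1 ha
    refine h.zero_notMem (v + w) ⟨a, ha, by rwa [inner_add_right, hav, zero_add]⟩ ?_
    rw [netForce_eq] at h0 ⊢
    refine convexHull_mono ?_ h0
    rintro f ⟨c, hc, ht, hf⟩
    obtain ⟨hc, hv⟩ := Finset.mem_filter.1 hc
    exact ⟨c, hc, (hv.touches_add w).2 ht, by rwa [hv.force_add]⟩

/-- Near a nonpenetrating unit velocity `v₀`, trajectories differ from `v₀` by trajectories of the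
contacts that vanish at `v₀`. -/
theorem exists_localize {S : Finset (Contact n)} {A : Finset (Vel n)}
    (hSA : ∀ c ∈ S, c.normal ∈ A) {v₀ : Vel n} (hv₁ : ‖v₀‖ = 1)
    (hv₀ : v₀ ∉ penetrating A) (M : ℝ≥0) :
    ∃ r > 0, ∃ C : ℝ, 0 ≤ C ∧ ∃ M' : ℝ≥0, ∀ T x G, IsTrajectory S A M T x G →
      (∀ t ∈ Icc 0 T, ‖x t - v₀‖ < r) →
      IsTrajectory (vanishingContacts S v₀) (vanishingNormals A v₀) M' T (fun t => x t - v₀)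
        (fun t => (C + 1) * G t - C * inner ℝ v₀ (x t)) := by
  classical
  have hA : ∀ a ∈ A, 0 ≤ inner ℝ a v₀ := fun a ha => not_lt.1 fun h => hv₀ ⟨a, ha, h⟩
  obtain ⟨C, hC, hev⟩ := exists_eventually_dissipates (S := S) (v₀ := v₀)
    fun c hc => hA _ (hSA c hc)
  -- A normal with positive component along `v₀` stays unpenetrated nearby, so only normals
  -- orthogonal to `v₀` matter.
  have hev' : ∀ᶠ v in 𝓝 v₀, ∀ a ∈ A, inner ℝ a v < 0 → inner ℝ a v₀ = 0 := by
    refine (eventually_all_finset A).2 fun a ha => ?_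
    rcases (hA a ha).eq_or_lt with h | h
    · exact Eventually.of_forall fun v _ => h.symm
    · have : ∀ᶠ v in 𝓝 v₀, 0 < inner ℝ a v :=
        (Continuous.tendsto (by fun_prop) v₀).eventually_const_lt h
      exact this.mono fun v hv hv' => absurd hv' hv.not_gt
  obtain ⟨r, hr, hball⟩ := Metric.eventually_nhds_iff.1 (hev.and hev')
  refine ⟨r, hr, C, hC, M + (C.toNNReal + 1) * M + C.toNNReal * (‖v₀‖₊ * M), ?_⟩
  intro T x G h hx
  have hnear : ∀ t ∈ Icc 0 T, dist (x t) v₀ < r := fun t ht => by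
    rw [dist_eq_norm]; exact hx t ht
  refine ⟨?_, ?_, ?_, ?_⟩
  · have h1 : LipschitzWith M (fun t => x t - v₀) := by
      simpa using h.lipschitz.sub (LipschitzWith.const v₀)
    exact h1.weaken (by rw [add_assoc]; exact le_self_add)
  · have h1 : LipschitzWith ((C.toNNReal + 1) * M) (fun t => (C + 1) * G t) := by
      have := (lipschitzWith_smul (β := ℝ) (C + 1)).comp h.lipschitz_defect
      have hn : ‖C + 1‖₊ = C.toNNReal + 1 := by
        ext; simp [abs_of_nonneg (show 0 ≤ C + 1 by linarith), hC]
      rwa [hn] at this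
    have h2 : LipschitzWith (C.toNNReal * (‖v₀‖₊ * M)) (fun t => C * inner ℝ v₀ (x t)) := by
      have h3 := (innerSL ℝ v₀).lipschitz.comp h.lipschitz
      have := (lipschitzWith_smul (β := ℝ) C).comp h3
      have hn : ‖C‖₊ = C.toNNReal := by ext; simp [hC]
      have hn' : ‖innerSL ℝ v₀‖₊ = ‖v₀‖₊ := by ext; simp
      rwa [hn, hn'] at this
    refine (h1.sub h2).weaken ?_
    rw [add_assoc]
    exact le_add_self
  · intro t ht
    obtain ⟨a, ha, hneg⟩ := h.mem t ht
    have h0 := (hball (hnear t ht)).2 a ha hneg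
    refine ⟨a, Finset.mem_filter.2 ⟨ha, h0⟩, ?_⟩
    rwa [inner_sub_right, h0, sub_zero]
  · filter_upwards [h.ae_mem] with t ht hm
    obtain ⟨p, hp, hdx, hdG⟩ := ht hm
    have hdiss := (hball (hnear t (Ioo_subset_Icc_self hm))).1
    -- Vanishing contacts create no defect; other contact forces pay `1 + ‖f‖` through the loss
    -- along `v₀`. For an arbitrary `e`, the extra `C * g` offsets a possible gain `C * inner ℝ v₀ e
    -- ≤ C * ‖e‖`.
    refine ⟨(p.1, (C + 1) * p.2 - C * inner ℝ v₀ p.1), ?_, hdx.sub_const v₀, ?_⟩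
    · refine map_mem_perturbedForce (S := S) (v := x t)
        (LinearMap.prod (LinearMap.fst ℝ (Vel n) ℝ)
          ((C + 1) • LinearMap.snd ℝ (Vel n) ℝ -
            C • ((innerSL ℝ v₀ : Vel n →ₗ[ℝ] ℝ) ∘ₗ LinearMap.fst ℝ (Vel n) ℝ))) ?_ ?_ hp
      · rintro f ⟨c, hc, htouch, hf⟩
        change (f, (C + 1) * 0 - C * inner ℝ v₀ f) ∈ _
        rw [mul_zero, zero_sub]
        rcases hdiss c hc htouch f hf with hvan | hle
        · rw [hvan.inner_eq_zero hf, mul_zero, neg_zero]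
          refine mem_perturbedForce_of_generator ⟨c, Finset.mem_filter.2 ⟨hc, hvan⟩, ?_, ?_⟩
          · rw [← hvan.touches_add, add_sub_cancel]; exact htouch
          · rw [← hvan.force_add, add_sub_cancel]; exact hf
        · exact mem_perturbedForce_of_le hle
      · intro e g heg
        refine mem_perturbedForce_of_le ?_
        change 1 + ‖e‖ ≤ (C + 1) * g - C * inner ℝ v₀ e
        have h1 : inner ℝ v₀ e ≤ ‖e‖ := by simpa [hv₁] using real_inner_le_norm v₀ e
        nlinarith [mul_le_mul_of_nonneg_left h1 hC, mul_le_mul_of_nonneg_left heg hC]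
    · exact (hdG.const_mul (C + 1)).sub
        (((innerSL ℝ v₀).hasFDerivAt.comp_hasDerivAt t hdx).const_mul C)

/-! ### Limits of trajectories and uniform dissipation -/

/-- Pointwise limits of trajectories with vanishing accumulated defect obey the unperturbed
inclusion wherever they are differentiable. -/
theorem mem_netForce_of_tendsto {S : Finset (Contact n)} {A : Finset (Vel n)} {M : ℝ≥0} {L : ℝ}
    {ι : Type*} {F : Filter ι} [F.NeBot] {x : ι → ℝ → Vel n} {G : ι → ℝ → ℝ} {y : ℝ → Vel n}
    (h : ∀ i, IsTrajectory S A M L (x i) (G i)) (hx : ∀ t, Tendsto (fun i => x i t) F (𝓝 (y t)))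
    (hG : Tendsto (fun i => G i L - G i 0) F (𝓝 0)) {t : ℝ} (ht : t ∈ Ioo 0 L) {p : Vel n}
    (hp : HasDerivAt y p t) : p ∈ netForce S (y t) := by
  by_contra hcon
  -- A functional separating `p` from the net forces at `y t` also bounds the generators nearby.
  -- Integrating it along the approximating trajectories, whose defect disappears in the limit,
  -- bounds the slope of `l ∘ y` by `u`.
  obtain ⟨l, u, hlt, hup⟩ := geometric_hahn_banach_closed_point
    (by rw [netForce_eq]; exact convex_convexHull ℝ _) (isCompact_netForce S (y t)).isClosed hcon
  have hev : ∀ᶠ v in 𝓝 (y t), ∀ f ∈ generators S v, l f < u :=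
    eventually_generators_lt l fun f hf => hlt f (by
      rw [netForce_eq]; exact subset_convexHull ℝ _ hf)
  obtain ⟨r, hr, hball⟩ := Metric.eventually_nhds_iff.1 hev
  -- At speed at most `M`, a trajectory within `r / 2` of `y t` at time `t` remains within `r` for
  -- time `η`.
  set η := min (r / (2 * (M + 1))) (L - t) with hη
  have hM : (0 : ℝ) ≤ M := M.2
  have hη0 : 0 < η := lt_min (by positivity) (by linarith [ht.2])
  have hηL : η ≤ L - t := min_le_right _ _
  have hηr : M * η ≤ r / 2 := by
    calc M * η ≤ (M + 1) * (r / (2 * (M + 1))) :=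
          mul_le_mul (by linarith) (min_le_left _ _) hη0.le (by linarith)
      _ = r / 2 := by field_simp
  have hly : HasDerivAt (fun s => l (y s)) (l p) t := l.hasFDerivAt.comp_hasDerivAt t hp
  refine absurd (le_of_hasDerivAt_of_forall_sub_le (u := u) hly hη0 fun s hs => ?_) (not_le.2 hup)
  set C := |u| + ‖l‖ with hC
  have hC0 : 0 ≤ C := by positivity
  have hclose : ∀ᶠ i in F, dist (x i t) (y t) < r / 2 :=
    (Metric.tendsto_nhds.1 (hx t)) _ (by linarith)
  have hle : ∀ᶠ i in F, l (x i s) - l (x i t) ≤ u * (s - t) + C * (G i L - G i 0) := by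
    filter_upwards [hclose] with i hi
    have hlip : LipschitzWith (‖l‖₊ * M + ‖C‖₊ * M) (fun τ => l (x i τ) - C * G i τ) :=
      (l.lipschitz.comp (h i).lipschitz).sub
        ((lipschitzWith_smul (β := ℝ) C).comp (h i).lipschitz_defect)
    have hsL : s ≤ L := by linarith [hs.2]
    have hint := sub_le_of_lipschitzWith_of_ae_deriv_le (c := u) hs.1.le hlip (by
      filter_upwards [(h i).ae_mem] with τ hτ hm
      obtain ⟨q, hq, hdx, hdG⟩ := hτ ⟨ht.1.trans hm.1, hm.2.trans_le hsL⟩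
      refine ⟨_, (l.hasFDerivAt.comp_hasDerivAt τ hdx).sub (hdG.const_mul C), ?_⟩
      have hd : dist (x i τ) (y t) < r := by
        have h1 := (h i).lipschitz.dist_le_mul τ t
        have h2 : dist τ t ≤ η := by
          rw [Real.dist_eq, abs_of_nonneg (by linarith [hm.1])]; linarith [hm.2, hs.2]
        have h3 := mul_le_mul_of_nonneg_left h2 hM
        linarith [dist_triangle (x i τ) (x i t) (y t)]
      have := apply_le_of_mem_perturbedForce l (fun f hf => (hball hd f hf).le) hq
      linarith)
    have h1 := (h i).defect_mono ht.1.le hs.1.le hsL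
    have h2 := (h i).defect_mono le_rfl ht.1.le ht.2.le
    have h3 := (h i).defect_mono (ht.1.le.trans hs.1.le) hsL le_rfl
    nlinarith
  have hlim1 : Tendsto (fun i => l (x i s) - l (x i t)) F (𝓝 (l (y s) - l (y t))) :=
    ((l.continuous.tendsto _).comp (hx s)).sub ((l.continuous.tendsto _).comp (hx t))
  have hlim2 : Tendsto (fun i => u * (s - t) + C * (G i L - G i 0)) F
      (𝓝 (u * (s - t) + C * 0)) := (hG.const_mul C).const_add _
  have := le_of_tendsto_of_tendsto hlim1 hlim2 hle
  simpa using this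

/-- A net force that does no work at `v` does no work at any velocity at which every contact
that vanishes at `v` vanishes. -/
theorem inner_eq_zero_of_mem_netForce {S : Finset (Contact n)} {v f w : Vel n}
    (hf : f ∈ netForce S v) (h0 : inner ℝ v f = 0)
    (hw : ∀ c ∈ S, c.Vanishes v → c.Vanishes w) : inner ℝ w f = 0 := by
  -- The sign condition is what makes this set convex: a zero sum of nonpositive terms has only zero
  -- terms.
  have hc : Convex ℝ {f : Vel n | inner ℝ v f ≤ 0 ∧ (inner ℝ v f = 0 → inner ℝ w f = 0)} := by
    rintro f ⟨hf, hf'⟩ g ⟨hg, hg'⟩ a b ha hb hab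
    change inner ℝ v (a • f + b • g) ≤ 0 ∧
      (inner ℝ v (a • f + b • g) = 0 → inner ℝ w (a • f + b • g) = 0)
    simp only [inner_add_right, real_inner_smul_right]
    have h1 := mul_nonpos_of_nonneg_of_nonpos ha hf
    have h2 := mul_nonpos_of_nonneg_of_nonpos hb hg
    refine ⟨by linarith, fun h => ?_⟩
    have h3 : a * inner ℝ v f = 0 := by linarith
    have h4 : b * inner ℝ v g = 0 := by linarith
    have h5 : a * inner ℝ w f = 0 := by
      rcases mul_eq_zero.1 h3 with h | h
      · simp [h]
      · simp [hf' h]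
    have h6 : b * inner ℝ w g = 0 := by
      rcases mul_eq_zero.1 h4 with h | h
      · simp [h]
      · simp [hg' h]
    rw [h5, h6, add_zero]
  rw [netForce_eq] at hf
  refine (convexHull_min ?_ hc hf).2 h0
  rintro f ⟨c, hcS, ht, hf⟩
  exact ⟨Contact.inner_nonpos ht hf, fun h =>
    (hw c hcS (Contact.vanishes_of_inner_eq_zero ht hf h)).inner_eq_zero hf⟩

/-- Solutions of constant norm are constant. -/
theorem eq_of_norm_eq_one {S : Finset (Contact n)} {M : ℝ≥0} {L : ℝ} (hL : 0 < L) {y : ℝ → Vel n}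
    (hy : LipschitzWith M y) (hnorm : ∀ t ∈ Icc 0 L, ‖y t‖ = 1)
    (hS : ∀ t ∈ Ioo 0 L, ∀ p, HasDerivAt y p t → p ∈ netForce S (y t)) :
    ∀ t ∈ Icc 0 L, y t = y 0 := by
  have hae : ∀ᵐ t, t ∈ Ioo 0 L → HasDerivAt y 0 t := by
    have hvan : ∀ᵐ t, ∀ c ∈ S, c.Vanishes (y t) → ∀ p, HasDerivAt y p t → c.Vanishes p := by
      refine (eventually_all_finset S).2 fun c _ => ?_
      filter_upwards [ae_hasDerivAt_eq_zero_of_eq_zero fun t => c.tangential (y t),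
        ae_hasDerivAt_eq_zero_of_eq_zero fun t => innerSL ℝ c.normal (y t)] with t h1 h2 hc p hp
      have h3 : innerSL ℝ c.normal p = 0 := h2 (by simpa using hc.1) _
        ((innerSL ℝ c.normal).hasFDerivAt.comp_hasDerivAt t hp)
      exact ⟨by simpa using h3, h1 hc.2 _ (c.tangential.hasFDerivAt.comp_hasDerivAt t hp)⟩
    filter_upwards [hvan, hy.ae_differentiableAt_real] with t h1 h2 hm
    have hp := h2.hasDerivAt
    set p := deriv y t
    have hsq : HasDerivAt (fun s => ‖y s‖ ^ 2) (2 * inner ℝ (y t) p) t := hp.norm_sq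
    have hconst : (fun s => ‖y s‖ ^ 2) =ᶠ[𝓝 t] fun _ => (1 : ℝ) := by
      filter_upwards [Ioo_mem_nhds hm.1 hm.2] with s hs
      rw [hnorm s (Ioo_subset_Icc_self hs), one_pow]
    have h0 : 2 * inner ℝ (y t) p = 0 :=
      hsq.unique ((hasDerivAt_const t (1 : ℝ)).congr_of_eventuallyEq hconst)
    -- The force `p` does no work at `y t`, and contacts vanishing at `y t` also vanish at `p`;
    -- hence `p` does no work at `p`.
    have hpp : inner ℝ p p = 0 :=
      inner_eq_zero_of_mem_netForce (hS t hm p hp) (by linarith) fun c hc hv => h1 c hc hv p hp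
    rwa [inner_self_eq_zero.1 hpp] at hp
  obtain ⟨v, hv⟩ := AbsolutelyContinuousOnInterval.const_of_ae_hasDerivAt_zero (a := 0) (b := L)
    (hy.lipschitzOnWith (s := uIcc 0 L)).absolutelyContinuousOnInterval (by
      have h1 : ∀ᵐ t : ℝ, t ≠ 0 := (Set.countable_singleton (0 : ℝ)).ae_notMem volume
      have h2 : ∀ᵐ t : ℝ, t ≠ L := (Set.countable_singleton L).ae_notMem volume
      filter_upwards [hae, h1, h2] with t ht h1 h2 hm
      rw [uIcc_of_le hL.le] at hm
      exact ht ⟨lt_of_le_of_ne hm.1 h1.symm, lt_of_le_of_ne hm.2 h2⟩)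
  rw [uIcc_of_le hL.le] at hv
  intro t ht
  rw [hv t ht, hv 0 ⟨le_rfl, hL.le⟩]

/-- Uniform dissipation of trajectories in a subspace, given time bounds near the nonpenetrating
unit velocities of the subspace. -/
theorem exists_norm_le_of_hasTimeBound {S : Finset (Contact n)} {A : Finset (Vel n)}
    (hnd : IsNondegenerateOn S A) (U : Submodule ℝ (Vel n)) (M : ℝ≥0) {L : ℝ} (hL : 0 < L)
    (hU : ∀ v ∈ U, ‖v‖ = 1 → HasTimeBound (vanishingContacts S v) (vanishingNormals A v)) :
    ∃ δ > 0, ∀ x G, IsTrajectory S A M L x G → (∀ t ∈ Icc 0 L, x t ∈ U) → ‖x 0‖ = 1 →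
      G L - G 0 ≤ δ → ‖x L‖ ≤ 1 - δ := by
  by_contra hcon
  push Not at hcon
  choose x G htraj hxU hx0 hGδ hxL using fun j : ℕ =>
    hcon (1 / ((j : ℝ) + 1)) Nat.one_div_pos_of_nat
  -- Along an ultrafilter, bounded trajectories converge at all times simultaneously.
  set F : Ultrafilter ℕ := hyperfilter ℕ with hF
  have hδ : Tendsto (fun j : ℕ => 1 / ((j : ℝ) + 1)) F (𝓝 0) :=
    tendsto_one_div_add_atTop_nhds_zero_nat.mono_left Nat.hyperfilter_le_atTop
  have hG0 : ∀ j, 0 ≤ G j L - G j 0 := fun j =>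
    sub_nonneg.2 ((htraj j).defect_mono le_rfl hL.le le_rfl)
  have hG : Tendsto (fun j => G j L - G j 0) F (𝓝 0) :=
    tendsto_of_tendsto_of_tendsto_of_le_of_le tendsto_const_nhds hδ hG0 hGδ
  have hlim : ∀ t, ∃ v, Tendsto (fun j => x j t) F (𝓝 v) := by
    intro t
    have hmem : ∀ j, x j t ∈ Metric.closedBall (0 : Vel n) (1 + M * |t|) := fun j => by
      have h1 := (htraj j).lipschitz.dist_le_mul t 0
      rw [Real.dist_0_eq_abs, dist_eq_norm] at h1
      rw [mem_closedBall_zero_iff]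
      calc ‖x j t‖ = ‖x j 0 + (x j t - x j 0)‖ := by rw [add_sub_cancel]
        _ ≤ _ := (norm_add_le _ _).trans (by rw [hx0 j]; linarith)
    obtain ⟨v, -, hv⟩ := (isCompact_closedBall (0 : Vel n) (1 + M * |t|)).ultrafilter_le_nhds
      (F.map fun j => x j t)
      (le_principal_iff.2 (mem_map.2 (Filter.univ_mem' hmem)))
    exact ⟨v, hv⟩
  choose y hy using hlim
  have hylip : LipschitzWith M y := LipschitzWith.of_dist_le_mul fun s t =>
    le_of_tendsto ((hy s).dist (hy t)) (Eventually.of_forall fun j =>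
      (htraj j).lipschitz.dist_le_mul s t)
  have hnorm : ∀ t ∈ Icc 0 L, ‖y t‖ = 1 := by
    intro t ht
    have hyt := (hy t).norm
    have e1 := fun j => (htraj j).defect_mono le_rfl ht.1 ht.2
    have e2 := fun j => (htraj j).defect_mono ht.1 ht.2 le_rfl
    refine le_antisymm ?_ ?_
    · have : Tendsto (fun j => 1 + (G j L - G j 0)) F (𝓝 (1 + 0)) := hG.const_add 1
      rw [add_zero] at this
      refine le_of_tendsto_of_tendsto hyt this (Eventually.of_forall fun j => ?_)
      change ‖x j t‖ ≤ 1 + (G j L - G j 0)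
      have := (htraj j).norm_sub_le le_rfl ht.1 ht.2
      rw [hx0 j] at this
      linarith [e2 j]
    · have : Tendsto (fun j : ℕ => 1 - 1 / ((j : ℝ) + 1) - (G j L - G j 0)) F (𝓝 (1 - 0 - 0)) :=
        (hδ.const_sub 1).sub hG
      rw [sub_zero, sub_zero] at this
      refine le_of_tendsto_of_tendsto this hyt (Eventually.of_forall fun j => ?_)
      change 1 - 1 / ((j : ℝ) + 1) - (G j L - G j 0) ≤ ‖x j t‖
      have := (htraj j).norm_sub_le ht.1 ht.2 le_rfl
      linarith [hxL j, e1 j]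
  have hnet : ∀ t ∈ Ioo 0 L, ∀ p, HasDerivAt y p t → p ∈ netForce S (y t) := fun t ht p hp =>
    mem_netForce_of_tendsto htraj hy hG ht hp
  have hconst := eq_of_norm_eq_one hL hylip hnorm hnet
  set v := y 0 with hv
  have hv1 : ‖v‖ = 1 := hnorm 0 ⟨le_rfl, hL.le⟩
  have hvU : v ∈ U := U.closed_of_finiteDimensional.mem_of_tendsto (hy 0)
    (Eventually.of_forall fun j => hxU j 0 ⟨le_rfl, hL.le⟩)
  have hvA : v ∉ penetrating A := by
    -- The constant limit has derivative zero, making zero a net force at `v`.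
    have hmid : L / 2 ∈ Ioo 0 L := ⟨by linarith, by linarith⟩
    have hd : HasDerivAt y 0 (L / 2) := by
      refine (hasDerivAt_const (L / 2) v).congr_of_eventuallyEq ?_
      filter_upwards [Ioo_mem_nhds hmid.1 hmid.2] with s hs
      exact hconst s (Ioo_subset_Icc_self hs)
    have h0 := hnet _ hmid 0 hd
    rw [hconst _ (Ioo_subset_Icc_self hmid)] at h0
    exact fun hvA => hnd.zero_notMem v hvA h0
  obtain ⟨r, hr, C, hC, M', hloc⟩ := exists_localize hnd.normal_mem hv1 hvA M
  obtain ⟨K, hK, hbound⟩ := hU v hvU hv1 M'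
  have hM : (0 : ℝ) ≤ M := M.2
  set η := min (r / (2 * (M + 1))) L with hη
  have hη0 : 0 < η := lt_min (by positivity) hL
  have hηL : η ≤ L := min_le_right _ _
  have hηr : M * η ≤ r / 2 := by
    calc M * η ≤ (M + 1) * (r / (2 * (M + 1))) :=
          mul_le_mul (by linarith) (min_le_left _ _) hη0.le (by linarith)
      _ = r / 2 := by field_simp
  have hclose : ∀ᶠ j in (F : Filter ℕ), dist (x j 0) v < r / 2 :=
    (Metric.tendsto_nhds.1 (hy 0)) _ (by linarith)
  -- The subsystem's time bound on `[0, η]`; its right-hand side tends to zero while `η` is fixed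
  -- and positive.
  have hle : ∀ᶠ j in (F : Filter ℕ), η ≤ K * (‖x j 0 - v‖ +
      ((C + 1) * (G j L - G j 0) - C * (inner ℝ v (x j η) - inner ℝ v (x j 0)))) := by
    filter_upwards [hclose] with j hj
    have := hbound η hη0.le _ _ (hloc η _ _ ((htraj j).restrict hηL) fun t ht => by
      have h1 := (htraj j).lipschitz.dist_le_mul t 0
      have h2 : dist t 0 ≤ η := by rw [Real.dist_0_eq_abs, abs_of_nonneg ht.1]; exact ht.2
      have h3 := mul_le_mul_of_nonneg_left h2 hM
      rw [← dist_eq_norm]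
      linarith [dist_triangle (x j t) (x j 0) v])
    refine this.trans (mul_le_mul_of_nonneg_left ?_ hK)
    have h4 := (htraj j).defect_mono hη0.le hηL le_rfl
    have h5 := mul_le_mul_of_nonneg_left h4 (show 0 ≤ C + 1 by linarith)
    change ‖x j 0 - v‖ + _ ≤ _
    linarith
  have hηv : Tendsto (fun j => x j η) F (𝓝 v) := by
    have := hy η
    rwa [hconst η ⟨hη0.le, hηL⟩] at this
  have hlim : Tendsto (fun j => K * (‖x j 0 - v‖ +
      ((C + 1) * (G j L - G j 0) - C * (inner ℝ v (x j η) - inner ℝ v (x j 0))))) F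
      (𝓝 (K * (‖v - v‖ + ((C + 1) * 0 - C * (inner ℝ v v - inner ℝ v v))))) := by
    have i1 : Tendsto (fun j => inner ℝ v (x j η)) F (𝓝 (inner ℝ v v)) :=
      tendsto_const_nhds.inner hηv
    have i2 : Tendsto (fun j => inner ℝ v (x j 0)) F (𝓝 (inner ℝ v v)) :=
      tendsto_const_nhds.inner (hy 0)
    exact ((((hy 0).sub_const v).norm).add
      ((hG.const_mul (C + 1)).sub ((i1.sub i2).const_mul C))).const_mul K
  have := ge_of_tendsto hlim hle
  simp at this
  linarith

/-! ### The linear time bound -/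

/-- Trajectories of a nondegenerate system stay in the penetrating set only for a time that is
bounded linearly by their initial norm and accumulated defect. -/
theorem IsNondegenerateOn.hasTimeBound {S : Finset (Contact n)} {A : Finset (Vel n)}
    (hnd : IsNondegenerateOn S A) : HasTimeBound S A := by
  classical
  induction hN : S.card + A.card using Nat.strong_induction_on generalizing S A with
  | _ N ih =>
  subst hN
  let N : Submodule ℝ (Vel n) :=
    { carrier := {v | (∀ c ∈ S, c.Vanishes v) ∧ ∀ a ∈ A, inner ℝ a v = 0}
      add_mem' := fun {v w} hv hw =>
        ⟨fun c hc => ⟨by rw [inner_add_right, (hv.1 c hc).1, (hw.1 c hc).1, add_zero],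
            by rw [map_add, (hv.1 c hc).2, (hw.1 c hc).2, add_zero]⟩,
          fun a ha => by rw [inner_add_right, hv.2 a ha, hw.2 a ha, add_zero]⟩
      zero_mem' := ⟨fun c _ => ⟨inner_zero_right _, map_zero _⟩, fun a _ => inner_zero_right _⟩
      smul_mem' := fun r v hv =>
        ⟨fun c hc => ⟨by rw [real_inner_smul_right, (hv.1 c hc).1, mul_zero],
            by rw [map_smul, (hv.1 c hc).2, smul_zero]⟩,
          fun a ha => by rw [real_inner_smul_right, hv.2 a ha, mul_zero]⟩ }
  -- If no contact or normal were lost, `v` would lie in both `N` and `Nᗮ`. For empty `S` and `A`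
  -- there is no unit vector in `Nᗮ`, so no separate base case is needed.
  have hU : ∀ v ∈ Nᗮ, ‖v‖ = 1 →
      HasTimeBound (vanishingContacts S v) (vanishingNormals A v) := by
    intro v hv hv1
    refine ih _ ?_ (hnd.vanishing v) rfl
    have h1 : (vanishingContacts S v).card ≤ S.card := Finset.card_filter_le _ _
    have h2 : (vanishingNormals A v).card ≤ A.card := Finset.card_filter_le _ _
    by_contra hlt
    have hS : vanishingContacts S v = S :=
      Finset.eq_of_subset_of_card_le (Finset.filter_subset _ _) (by omega)
    have hA : vanishingNormals A v = A :=
      Finset.eq_of_subset_of_card_le (Finset.filter_subset _ _) (by omega)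
    have hvN : v ∈ N := ⟨Finset.filter_eq_self.1 hS, Finset.filter_eq_self.1 hA⟩
    have h0 : inner ℝ v v = 0 := (Submodule.mem_orthogonal _ _).1 hv v hvN
    rw [inner_self_eq_zero.1 h0, norm_zero] at hv1
    exact zero_ne_one hv1
  intro M
  obtain ⟨δ, hδ, hdiss⟩ := exists_norm_le_of_hasTimeBound hnd Nᗮ M one_pos hU
  set B := 1 / δ with hB
  have hB0 : 0 < B := by positivity
  have hBδ : B * δ = 1 := by rw [hB]; field_simp
  set K := 1 + B with hK
  refine ⟨2 * K, by positivity, fun T hT z G hz => ?_⟩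
  have hproj := hz.project (N := N) (fun v hv => hv.1) (fun v hv => hv.2)
  set x : ℝ → Vel n := fun t => Nᗮ.starProjection (z t) with hx
  have hxU : ∀ t, x t ∈ Nᗮ := fun t => Submodule.starProjection_apply_mem _ _
  have hx0 : ‖x 0‖ ≤ ‖z 0‖ := Nᗮ.norm_starProjection_apply_le _
  have hGT := hproj.defect_mono le_rfl hT le_rfl
  have hxc := hproj.lipschitz.continuous
  have hGc := hproj.lipschitz_defect.continuous
  -- These are the times already paid for by loss of norm and by defect. The factor `2` lets the
  -- defect cover both the norm growth it may cause and the elapsed time.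
  set Q : Set ℝ := {t | t ∈ Icc 0 T ∧ t ≤ K * (‖x 0‖ - ‖x t‖ + 2 * (G t - G 0))} with hQ
  have hQc : IsCompact Q := by
    refine isCompact_Icc.inter_right ?_
    exact isClosed_le continuous_id (by fun_prop)
  have hQ0 : (0 : ℝ) ∈ Q := ⟨⟨le_rfl, hT⟩, by simp⟩
  obtain ⟨t, htQ, htmax⟩ := hQc.exists_isMaxOn ⟨0, hQ0⟩ continuousOn_id
  have htmax : ∀ s ∈ Q, s ≤ t := fun s hs => htmax hs
  obtain ⟨htT, ht⟩ := htQ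
  have hρ : 0 < ‖x t‖ := norm_pos_iff.2 (ne_zero_of_mem_penetrating (hproj.mem t htT))
  set ρ := ‖x t‖ with hρdef
  rcases le_or_gt (t + ρ) T with hle | hgt
  · exfalso
    have hresc := hproj.rescale (a := t) (r := ρ) (L := 1) htT.1 hρ (by linarith)
    have hmono := hproj.defect_mono htT.1 (show t ≤ t + ρ by linarith) hle
    have hnsub := hproj.norm_sub_le htT.1 (show t ≤ t + ρ by linarith) hle
    have key : ρ ≤ K * (ρ - ‖x (t + ρ)‖ + 2 * (G (t + ρ) - G t)) := by
      -- Over a time equal to the current norm `ρ`, either the defect is small and the rescaled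
      -- dissipation removes `δ * ρ` from the norm, or the defect itself exceeds `δ * ρ`.
      by_cases hcase : G (t + ρ) - G t ≤ δ * ρ
      · have h1 := hdiss _ _ hresc (fun s _ => Nᗮ.smul_mem _ (hxU _))
          (by
            rw [mul_zero, add_zero, norm_smul, Real.norm_of_nonneg (inv_nonneg.2 hρ.le)]
            exact inv_mul_cancel₀ hρ.ne')
          (by
            rw [mul_one, mul_zero, add_zero, ← mul_sub, inv_mul_le_iff₀ hρ, mul_comm]
            exact hcase)
        rw [mul_one, norm_smul, Real.norm_of_nonneg (inv_nonneg.2 hρ.le),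
          inv_mul_le_iff₀ hρ] at h1
        have h2 : δ * ρ ≤ ρ - ‖x (t + ρ)‖ + 2 * (G (t + ρ) - G t) := by nlinarith
        have h3 := mul_le_mul_of_nonneg_left h2 hB0.le
        rw [← mul_assoc, hBδ, one_mul] at h3
        have h4 : 0 ≤ ρ - ‖x (t + ρ)‖ + 2 * (G (t + ρ) - G t) := by linarith
        rw [hK]; linarith
      · have h2 : δ * ρ ≤ ρ - ‖x (t + ρ)‖ + 2 * (G (t + ρ) - G t) := by
          linarith [not_le.1 hcase]
        have h3 := mul_le_mul_of_nonneg_left h2 hB0.le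
        rw [← mul_assoc, hBδ, one_mul] at h3
        have h4 : 0 ≤ ρ - ‖x (t + ρ)‖ + 2 * (G (t + ρ) - G t) := by linarith
        rw [hK]; linarith
    have := htmax (t + ρ) ⟨⟨by linarith [htT.1], hle⟩, by linarith⟩
    linarith
  -- Less than `ρ` of time remains, covered by the unspent `K * ρ` since `K ≥ 1`.
  · have h1 := hproj.defect_mono htT.1 htT.2 le_rfl
    have h2 : ρ ≤ K * ρ := by rw [hK]; nlinarith
    have h3 : K * (G t - G 0) ≤ K * (G T - G 0) :=
      mul_le_mul_of_nonneg_left (by linarith) (by positivity)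
    have h4 : K * ‖x 0‖ ≤ K * ‖z 0‖ := mul_le_mul_of_nonneg_left hx0 (by positivity)
    have h5 : 0 ≤ K * ‖z 0‖ := by positivity
    linarith

/-! ### From solutions to trajectories, and the conclusion -/

theorem absolutelyContinuousOnInterval_comp_lipschitzWith {X Y : Type*} [PseudoMetricSpace X]
    [PseudoMetricSpace Y] {K : ℝ≥0} {g : X → Y} (hg : LipschitzWith K g) {f : ℝ → X} {a b : ℝ}
    (hf : AbsolutelyContinuousOnInterval f a b) :
    AbsolutelyContinuousOnInterval (fun t => g (f t)) a b := by
  rw [absolutelyContinuousOnInterval_iff] at hf ⊢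
  intro ε hε
  have hK : (0 : ℝ) ≤ K := K.2
  obtain ⟨δ, hδ, h⟩ := hf (ε / (K + 1)) (by positivity)
  refine ⟨δ, hδ, fun E hE hlt => ?_⟩
  have h1 := h E hE hlt
  rw [lt_div_iff₀ (by positivity)] at h1
  calc ∑ i ∈ Finset.range E.1, dist (g (f (E.2 i).1)) (g (f (E.2 i).2))
      ≤ ∑ i ∈ Finset.range E.1, K * dist (f (E.2 i).1) (f (E.2 i).2) :=
        Finset.sum_le_sum fun i _ => hg.dist_le_mul _ _
    _ = K * ∑ i ∈ Finset.range E.1, dist (f (E.2 i).1) (f (E.2 i).2) := by rw [Finset.mul_sum]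
    _ ≤ (∑ i ∈ Finset.range E.1, dist (f (E.2 i).1) (f (E.2 i).2)) * (K + 1) := by
        have : 0 ≤ ∑ i ∈ Finset.range E.1, dist (f (E.2 i).1) (f (E.2 i).2) :=
          Finset.sum_nonneg fun i _ => dist_nonneg
        linarith
    _ < ε := h1

theorem norm_sub_le_of_ae_norm_deriv_le {v : ℝ → Vel n} {a b B : ℝ} (hab : a ≤ b)
    (hv : AbsolutelyContinuousOnInterval v a b)
    (h : ∀ᵐ t, t ∈ Ioo a b → ∃ p, HasDerivAt v p t ∧ ‖p‖ ≤ B) : ‖v b - v a‖ ≤ B * (b - a) := by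
  rcases eq_or_ne (v b - v a) 0 with h0 | h0
  · rcases hab.eq_or_lt with rfl | hlt
    · simp
    · rw [h0, norm_zero]
      -- The sign of `B` is not assumed; it is read off from the derivative bound at one point.
      have hB : ∃ᵐ t : ℝ, t ∈ Ioo a b := by
        rw [frequently_ae_mem_iff, Real.volume_Ioo]
        simpa using hlt
      obtain ⟨t, htm, ht⟩ := (hB.and_eventually h).exists
      obtain ⟨p, -, hp⟩ := ht htm
      exact mul_nonneg ((norm_nonneg p).trans hp) (by linarith)
  · set w := v b - v a with hw
    have hpos : 0 < ‖w‖ := norm_pos_iff.2 h0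
    have := sub_le_of_ae_deriv_le (φ := fun t => innerSL ℝ w (v t)) (c := ‖w‖ * B) hab
      (absolutelyContinuousOnInterval_comp_lipschitzWith (innerSL ℝ w).lipschitz hv) (by
        filter_upwards [h] with t ht hm
        obtain ⟨p, hp, hpB⟩ := ht hm
        refine ⟨_, (innerSL ℝ w).hasFDerivAt.comp_hasDerivAt t hp, ?_⟩
        rw [innerSL_apply_apply]
        exact (real_inner_le_norm w p).trans (mul_le_mul_of_nonneg_left hpB hpos.le))
    rw [innerSL_apply_apply, innerSL_apply_apply, ← inner_sub_right, ← hw,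
      real_inner_self_eq_norm_sq] at this
    nlinarith

theorem derivativeMap_of_mem_activeSet {C : Finset (Contact n)} {v : Vel n}
    (hv : v ∈ activeSet C) : derivativeMap C v = netForce C v := by
  have h : v ∉ inactiveSet C := fun h => interior_subset h hv
  rw [derivativeMap, if_neg h, if_pos hv]

/-- A penetrating solution, extended by constants, is a trajectory without defect. -/
theorem exists_isTrajectory {C : Finset (Contact n)} {A : Finset (Vel n)}
    (hA : penetrating A = activeSet C) :
    ∃ M : ℝ≥0, ∀ s, 0 < s → ∀ v ∈ solutionSet (derivativeMap C) 0 s,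
      v '' Icc 0 s ⊆ activeSet C →
      ∃ x, IsTrajectory C A M s x (fun _ => 0) ∧ x 0 = v 0 ∧ x s = v s := by
  obtain ⟨B, hB, hbound⟩ := exists_norm_le_of_mem_netForce C
  refine ⟨B.toNNReal, fun s hs v ⟨hac, hae⟩ hact => ?_⟩
  have hmem : ∀ t ∈ Icc 0 s, v t ∈ activeSet C := fun t ht => hact ⟨t, ht, rfl⟩
  have hae' : ∀ᵐ t, t ∈ Icc 0 s → ∃ p ∈ netForce C (v t), HasDerivAt v p t := by
    filter_upwards [(ae_restrict_iff' measurableSet_Icc).1 hae] with t ht hm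
    have := ht hm
    rwa [derivativeMap_of_mem_activeSet (hmem t hm)] at this
  have hlip : ∀ a b, 0 ≤ a → a ≤ b → b ≤ s → ‖v b - v a‖ ≤ B * (b - a) := by
    intro a b ha hab hb
    refine norm_sub_le_of_ae_norm_deriv_le hab (hac.mono ?_) ?_
    · rw [uIcc_of_le hab, uIcc_of_le hs.le]
      exact Icc_subset_Icc ha hb
    · filter_upwards [hae'] with t ht hm
      obtain ⟨p, hp, hd⟩ := ht ⟨ha.trans hm.1.le, hm.2.le.trans hb⟩
      exact ⟨p, hd, hbound _ _ hp⟩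
  have hlip' : LipschitzOnWith B.toNNReal v (Icc 0 s) := by
    refine LipschitzOnWith.of_dist_le_mul fun a ha b hb => ?_
    rw [Real.coe_toNNReal _ hB]
    rcases le_total a b with hab | hab
    · rw [dist_comm, dist_eq_norm, dist_comm, Real.dist_eq, abs_of_nonneg (by linarith)]
      exact hlip a b ha.1 hab hb.2
    · rw [dist_eq_norm, Real.dist_eq, abs_of_nonneg (by linarith)]
      exact hlip b a hb.1 hab ha.2
  have hproj : ∀ t ∈ Icc 0 s, (projIcc 0 s hs.le t : ℝ) = t := fun t ht => by
    rw [projIcc_of_mem hs.le ht]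
  refine ⟨fun t => v (projIcc 0 s hs.le t), ⟨?_, LipschitzWith.const' 0, ?_, ?_⟩, ?_, ?_⟩
  · refine LipschitzWith.of_dist_le_mul fun a b => ?_
    refine (hlip'.dist_le_mul _ (projIcc 0 s hs.le a).2 _ (projIcc 0 s hs.le b).2).trans ?_
    refine mul_le_mul_of_nonneg_left ?_ (NNReal.coe_nonneg _)
    have := (LipschitzWith.projIcc hs.le).dist_le_mul a b
    rwa [NNReal.coe_one, one_mul] at this
  · intro t ht
    rw [hproj t ht, hA]
    exact hmem t ht
  · filter_upwards [hae'] with t ht hm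
    obtain ⟨p, hp, hd⟩ := ht (Ioo_subset_Icc_self hm)
    refine ⟨(p, 0), ?_, ?_, hasDerivAt_const t 0⟩
    · rw [hproj t (Ioo_subset_Icc_self hm)]
      exact mem_perturbedForce_of_netForce hp
    · refine hd.congr_of_eventuallyEq ?_
      filter_upwards [Ioo_mem_nhds hm.1 hm.2] with τ hτ
      rw [hproj τ (Ioo_subset_Icc_self hτ)]
  · exact congrArg v (hproj 0 ⟨le_rfl, hs.le⟩)
  · exact congrArg v (hproj s ⟨hs.le, le_rfl⟩)

/-- Nondegenerate contact sets are dissipative. -/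
theorem nondegenerateSystems_subset_dissipativeSystems :
    nondegenerateSystems n ⊆ dissipativeSystems n := by
  classical
  intro C hC
  set A := C.image Contact.normal with hAdef
  have hA : penetrating A = activeSet C := by
    ext v
    simp [penetrating, activeSet, hAdef]
  have hnd : IsNondegenerateOn C A :=
    ⟨fun c hc => Finset.mem_image_of_mem _ hc, fun v hv => hC v (hA ▸ hv)⟩
  obtain ⟨M, hM⟩ := exists_isTrajectory hA
  have hδ : ∀ s : ℝ, ∃ δ : ℝ, 0 < s → 0 < δ ∧ ∀ x G, IsTrajectory C A M s x G →
      (∀ t ∈ Icc 0 s, x t ∈ (⊤ : Submodule ℝ (Vel n))) → ‖x 0‖ = 1 → G s - G 0 ≤ δ →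
      ‖x s‖ ≤ 1 - δ := by
    intro s
    by_cases hs : 0 < s
    -- All subsystems now have time bounds, so no projection is needed and `U` is the whole space.
    · obtain ⟨δ, hδ, h⟩ := exists_norm_le_of_hasTimeBound hnd ⊤ M hs
        fun v _ _ => (hnd.vanishing v).hasTimeBound
      exact ⟨δ, fun _ => ⟨hδ, h⟩⟩
    · exact ⟨0, fun h => absurd h hs⟩
  choose δ hδ using hδ
  -- The cap `1 / 2` keeps the rate below `1`.
  refine ⟨fun s => if 0 < s then min (δ s) (1 / 2) else 0, ⟨fun s _ => ?_, fun s hs => ?_⟩, ?_⟩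
  · by_cases hs : 0 < s
    · simp only [if_pos hs]
      exact ⟨le_min (hδ s hs).1.le (by norm_num), (min_le_right _ _).trans_lt (by norm_num)⟩
    · simp [hs]
  · simp only [if_pos hs]
    exact lt_min (hδ s hs).1 (by norm_num)
  · intro s hs v hv hact hv0
    obtain ⟨x, hx, hx0, hxs⟩ := hM s hs v hv hact
    have := (hδ s hs).2 x _ hx (fun _ _ => Submodule.mem_top) (by rw [hx0, hv0])
      (by simpa using (hδ s hs).1.le)
    rw [hxs] at this
    simp only [if_pos hs]
    linarith [min_le_left (δ s) (1 / 2)]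

end FrictionalImpact

theorem mainTheorem2 (n m k : ℕ)
    (ih : ∀ m' k' : ℕ, k' ≤ m' → (k' < k ∨ (k' = k ∧ m' < m)) →
      FrictionalImpact.nondegenerateSystems n ∩ FrictionalImpact.sizedSystems n m' k' ⊆
        FrictionalImpact.dissipativeSystems n) :
    FrictionalImpact.nondegenerateSystems n ∩ FrictionalImpact.sizedSystems n m k ⊆
      FrictionalImpact.dissipativeSystems n :=
  fun _ hC => FrictionalImpact.nondegenerateSystems_subset_dissipativeSystems hC.1
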